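/- Let $\mathbb{T}=\mathbb{R}/\mathbb{Z}$ with Lebesgue measure, and let $\phi(x)=\frac1x+\frac1{1-x}$ for $x\in(0,1)$, regarded as a function defined almost everywhere on $\mathbb{T}$ by identifying $\mathbb{T}$ with $[0,1)$. For $\alpha,\beta\in\mathbb{T}$ and $N\ge 1$ put $$S_N(\phi)(x)=\sum_{k=0}^{N-1}\phi(x+k\alpha),\qquad \Theta_N^\beta(x)=\frac{S_N(\phi)(x)}{S_N(\phi)(x-\beta)}.$$ Then there exists a set $Z\subset\mathbb{T}^2$ of full Lebesgue measure such that for every $(\alpha,\beta)\in Z$, $$\limsup_{N\to\infty}\Theta_N^\beta(x)=\infty\quad\text{and}\quad\liminf_{N\to\infty}\Theta_N^\beta(x)=0\qquad\text{for a.e. }x\in\mathbb{T}.$$ -/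

import Mathlib

noncomputable section

/-- The observable `φ(x) = 1/x + 1/(1-x)` on the circle `ℝ/ℤ`, where a point is identified with its
representative in `[0, 1)`. (At the single point `0`, where the formula is undefined, the
value is irrelevant for almost-everywhere statements.) -/
def phi (x : UnitAddCircle) : ℝ :=
  1 / (AddCircle.equivIco 1 0 x : ℝ) + 1 / (1 - (AddCircle.equivIco 1 0 x : ℝ))

/-- The rotation `R_α(x) = x + α` of the circle. -/
def circleRotation (α x : UnitAddCircle) : UnitAddCircle := x + α

/-- The ratio `Θ_N^β(x) = S_N(φ)(x) / S_N(φ)(x - β)` of Birkhoff sums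
`S_N(φ)(x) = ∑_{k=0}^{N-1} φ(R_α^k x)`. -/
def Theta (α β : UnitAddCircle) (N : ℕ) (x : UnitAddCircle) : ℝ :=
  birkhoffSum (circleRotation α) phi N x / birkhoffSum (circleRotation α) phi N (x - β)

end

/-!
The tail of `φ` is comparable to `1/t`, so cutting `φ` off at height of order `N` shows that
`S_N(φ)(y)` is at most `C N log N` outside a set of `y` of small measure, uniformly in the rotation.
On the other hand `∑ 1/(N log N)` diverges and, for random `(α, x)`, the orbit points `x + nα` are
pairwise independent and uniform, so by a second moment argument a single term `φ(x + nα)` exceeds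
`M C N log N`, with `N = n + 1`, for infinitely many `n`. These events depend only on `(α, x)`: for
an independent second base point `y`, they rarely fail to be accompanied by `S_N(φ)(y) ≤ C N log N`.
Hence `S_N(φ)(x) ≥ M S_N(φ)(y)` infinitely often for almost every `((α, x), y)`, and both claims
follow by taking `x - β` for `y`, respectively `x` for `y` and `x - β` for `x`.
-/

open MeasureTheory Set Filter Topology ProbabilityTheory Asymptotics

section BirkhoffSums

theorem birkhoffSum_pos {X M : Type*} [AddCommMonoid M] [PartialOrder M]
    [IsOrderedCancelAddMonoid M] {T : X → X} {f : X → M} (hf0 : ∀ x, 0 < f x) {n : ℕ}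
    (hn : n ≠ 0) (x : X) : 0 < birkhoffSum T f n x :=
  Finset.sum_pos (fun _ _ ↦ hf0 _) (Finset.nonempty_range_iff.2 hn)

theorem apply_iterate_le_birkhoffSum_succ {X M : Type*} [AddCommMonoid M] [PartialOrder M]
    [IsOrderedAddMonoid M] {T : X → X} {f : X → M} (hf0 : 0 ≤ f) (n : ℕ) (x : X) :
    f (T^[n] x) ≤ birkhoffSum T f (n + 1) x := by
  rw [birkhoffSum_succ]
  exact le_add_of_nonneg_left (Finset.sum_nonneg fun _ _ ↦ hf0 _)

variable {Ω : Type*} [MeasurableSpace Ω] {μ : Measure Ω}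

theorem integral_birkhoffSum {E : Type*} [NormedAddCommGroup E] [NormedSpace ℝ E]
    {T : Ω → Ω} (hT : MeasurePreserving T μ μ) {g : Ω → E} (hg : Integrable g μ) (n : ℕ) :
    ∫ ω, birkhoffSum T g n ω ∂μ = n • ∫ ω, g ω ∂μ := by
  have hcomp (k : ℕ) : ∫ ω, g (T^[k] ω) ∂μ = ∫ ω, g ω ∂μ := by
    rw [← integral_map (hT.iterate k).aemeasurable, (hT.iterate k).map_eq]
    rw [(hT.iterate k).map_eq]
    exact hg.aestronglyMeasurable
  calc ∫ ω, birkhoffSum T g n ω ∂μ = ∑ k ∈ Finset.range n, ∫ ω, g (T^[k] ω) ∂μ :=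
        integral_finsetSum _ fun k _ ↦ (hT.iterate k).integrable_comp_of_integrable hg
    _ = n • ∫ ω, g ω ∂μ := by simp only [hcomp, Finset.sum_const, Finset.card_range]

theorem integrable_birkhoffSum {E : Type*} [NormedAddCommGroup E]
    {T : Ω → Ω} (hT : MeasurePreserving T μ μ) {g : Ω → E} (hg : Integrable g μ) (n : ℕ) :
    Integrable (birkhoffSum T g n) μ :=
  integrable_finsetSum _ fun k _ ↦ (hT.iterate k).integrable_comp_of_integrable hg

theorem integrable_min_const [IsFiniteMeasure μ] {f : Ω → ℝ} (hf : Measurable f) (hf0 : 0 ≤ f)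
    {s : ℝ} (hs : 0 ≤ s) : Integrable (fun ω ↦ min (f ω) s) μ :=
  .of_mem_Icc 0 s (by fun_prop) (ae_of_all _ fun ω ↦ ⟨le_min (hf0 ω) hs, min_le_right _ _⟩)

theorem measureReal_lt_birkhoffSum_le [IsFiniteMeasure μ] {T : Ω → Ω}
    (hT : MeasurePreserving T μ μ) {f : Ω → ℝ} (hf : Measurable f) (hf0 : 0 ≤ f) (n : ℕ)
    {s c : ℝ} (hs : 0 ≤ s) (hc : 0 < c) :
    μ.real {ω | c < birkhoffSum T f n ω} ≤
      n * μ.real {ω | s ≤ f ω} + n * (∫ ω, min (f ω) s ∂μ) / c := by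
  set g : Ω → ℝ := fun ω ↦ min (f ω) s
  have hg : Integrable g μ := integrable_min_const hf hf0 hs
  have hsub : {ω | c < birkhoffSum T f n ω} ⊆
      (⋃ k ∈ Finset.range n, T^[k] ⁻¹' {ω | s ≤ f ω}) ∪ {ω | c ≤ birkhoffSum T g n ω} := by
    intro ω hω
    by_cases h : ∃ k ∈ Finset.range n, s ≤ f (T^[k] ω)
    · exact .inl (by simpa using h)
    · push Not at h
      have hfg : birkhoffSum T g n ω = birkhoffSum T f n ω :=
        Finset.sum_congr rfl fun k hk ↦ min_eq_left (h k hk).le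
      exact .inr (hω.le.trans_eq hfg.symm)
  have hlarge : μ.real (⋃ k ∈ Finset.range n, T^[k] ⁻¹' {ω | s ≤ f ω}) ≤
      n * μ.real {ω | s ≤ f ω} := by
    refine (measureReal_biUnion_finset_le _ _).trans_eq ?_
    have hms : NullMeasurableSet {ω | s ≤ f ω} μ :=
      (measurableSet_le measurable_const hf).nullMeasurableSet
    simp only [(hT.iterate _).measureReal_preimage hms, Finset.sum_const, Finset.card_range,
      nsmul_eq_mul]
  have hsmall : μ.real {ω | c ≤ birkhoffSum T g n ω} ≤ n * (∫ ω, g ω ∂μ) / c := by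
    rw [le_div_iff₀' hc, ← nsmul_eq_mul, ← integral_birkhoffSum hT hg]
    exact mul_meas_ge_le_integral_of_nonneg
      (ae_of_all _ fun ω ↦ Finset.sum_nonneg fun k _ ↦ le_min (hf0 _) hs)
      (integrable_birkhoffSum hT hg n) c
  exact (measureReal_mono hsub).trans <|
    (measureReal_union_le _ _).trans (add_le_add hlarge hsmall)

variable [IsProbabilityMeasure μ] {f : Ω → ℝ}

theorem exists_measureReal_le_mul_inv
    (htail : (fun t ↦ μ.real {ω | t ≤ f ω}) =O[atTop] fun t : ℝ ↦ t⁻¹) :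
    ∃ K > 0, ∀ t > 0, μ.real {ω | t ≤ f ω} ≤ K * t⁻¹ := by
  obtain ⟨K, hK, hKtail⟩ := htail.exists_pos
  obtain ⟨t₀, ht₀⟩ := eventually_atTop.1 hKtail.bound
  refine ⟨max K t₀, lt_max_of_lt_left hK, fun t ht ↦ ?_⟩
  obtain h | h := le_total t₀ t
  · have hKt : μ.real {ω | t ≤ f ω} ≤ K * t⁻¹ := by
      simpa only [Real.norm_of_nonneg measureReal_nonneg,
        Real.norm_of_nonneg (inv_nonneg.2 ht.le)] using ht₀ t h
    exact hKt.trans (by gcongr; exact le_max_left K t₀)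
  · calc μ.real {ω | t ≤ f ω} ≤ 1 := measureReal_le_one
      _ = t * t⁻¹ := (mul_inv_cancel₀ ht.ne').symm
      _ ≤ max K t₀ * t⁻¹ := by gcongr; exact h.trans (le_max_right K t₀)

theorem integral_min_le_one_add_mul_log (hf : Measurable f) (hf0 : 0 ≤ f) {K s : ℝ}
    (htail : ∀ t > 0, μ.real {ω | t ≤ f ω} ≤ K * t⁻¹) (hs : 1 ≤ s) :
    ∫ ω, min (f ω) s ∂μ ≤ 1 + K * Real.log s := by
  have hs0 : 0 ≤ s := zero_le_one.trans hs
  have htail_int (a b : ℝ) : IntervalIntegrable (fun t ↦ μ.real {ω | t ≤ f ω}) volume a b :=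
    Antitone.intervalIntegrable fun _ _ hst ↦ measureReal_mono fun _ h ↦ hst.trans h
  have hlayer : ∫ ω, min (f ω) s ∂μ = ∫ t in 0..s, μ.real {ω | t ≤ f ω} := by
    rw [(integrable_min_const hf hf0 hs0).integral_eq_integral_Ioc_meas_le
      (ae_of_all _ fun ω ↦ le_min (hf0 ω) hs0) (ae_of_all _ fun ω ↦ min_le_right _ _),
      intervalIntegral.integral_of_le hs0]
    refine setIntegral_congr_fun measurableSet_Ioc fun t ht ↦ ?_
    simp only [le_min_iff, ht.2, and_true]
  have hhead : ∫ t in (0 : ℝ)..1, μ.real {ω | t ≤ f ω} ≤ 1 := by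
    calc _ ≤ ∫ _ in (0 : ℝ)..1, (1 : ℝ) :=
          intervalIntegral.integral_mono_on zero_le_one (htail_int 0 1)
            intervalIntegrable_const fun _ _ ↦ measureReal_le_one
      _ = 1 := by simp
  have hrest : ∫ t in 1..s, μ.real {ω | t ≤ f ω} ≤ K * Real.log s := by
    have hpos : ∀ t ∈ Icc 1 s, 0 < t := fun t ht ↦ zero_lt_one.trans_le ht.1
    calc _ ≤ ∫ t in 1..s, K * t⁻¹ := by
          refine intervalIntegral.integral_mono_on hs (htail_int 1 s) ?_
            fun t ht ↦ htail t (hpos t ht)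
          exact (intervalIntegral.intervalIntegrable_inv
            (fun t ht ↦ (hpos t (uIcc_of_le hs ▸ ht)).ne') continuousOn_id).const_mul K
      _ = K * Real.log s := by
          rw [intervalIntegral.integral_const_mul,
            integral_inv_of_pos zero_lt_one (zero_lt_one.trans_le hs), div_one]
  rw [hlayer, ← intervalIntegral.integral_add_adjacent_intervals (htail_int 0 1) (htail_int 1 s)]
  exact add_le_add hhead hrest

-- Truncating `f` at height `2 * K / η * n` makes both terms of the truncation bound at most
-- `η / 2`.
theorem exists_eventually_measureReal_lt_birkhoffSum_le (hf : Measurable f) (hf0 : 0 ≤ f)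
    (htail : (fun t ↦ μ.real {ω | t ≤ f ω}) =O[atTop] fun t : ℝ ↦ t⁻¹) {η : ℝ} (hη : 0 < η) :
    ∃ C > 0, ∀ᶠ n : ℕ in atTop, ∀ T : Ω → Ω, MeasurePreserving T μ μ →
      μ.real {ω | C * (n * Real.log n) < birkhoffSum T f n ω} ≤ η := by
  obtain ⟨K, hK, hKtail⟩ := exists_measureReal_le_mul_inv htail
  set a : ℝ := 2 * K / η
  have ha : 0 < a := by positivity
  have hcast := tendsto_natCast_atTop_atTop (R := ℝ)
  refine ⟨6 * K / η, by positivity, ?_⟩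
  filter_upwards [hcast.eventually_ge_atTop a, hcast.eventually_ge_atTop a⁻¹,
    hcast.eventually_gt_atTop 1,
    (Real.tendsto_log_atTop.comp hcast).eventually_ge_atTop K⁻¹] with n han hainv hn hlogK T hT
  have hn0 : (0 : ℝ) < n := zero_lt_one.trans hn
  have hlog : 0 < Real.log n := Real.log_pos hn
  have hs : 1 ≤ a * n := (inv_le_iff_one_le_mul₀' ha).1 hainv
  have hmin : ∫ ω, min (f ω) (a * n) ∂μ ≤ 3 * K * Real.log n := by
    have hone : 1 ≤ K * Real.log n := (inv_le_iff_one_le_mul₀' hK).1 hlogK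
    have hloga : Real.log (a * n) ≤ 2 * Real.log n := by
      rw [Real.log_mul ha.ne' hn0.ne']
      linarith [Real.log_le_log ha han]
    calc _ ≤ 1 + K * Real.log (a * n) := integral_min_le_one_add_mul_log hf hf0 hKtail hs
      _ ≤ K * Real.log n + K * (2 * Real.log n) := by gcongr
      _ = 3 * K * Real.log n := by ring
  calc _ ≤ n * μ.real {ω | a * n ≤ f ω} +
          n * (∫ ω, min (f ω) (a * n) ∂μ) / (6 * K / η * (n * Real.log n)) :=
        measureReal_lt_birkhoffSum_le hT hf hf0 n (zero_le_one.trans hs) (by positivity)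
    _ ≤ n * (K * (a * n)⁻¹) + n * (3 * K * Real.log n) / (6 * K / η * (n * Real.log n)) := by
        gcongr
        exact hKtail _ (by positivity)
    _ = η := by simp only [a]; field_simp; norm_num

end BirkhoffSums

section BorelCantelli

variable {Ω ι : Type*} [MeasurableSpace Ω] {μ : Measure Ω} {A E : ι → Set Ω} {I : Finset ι}

theorem indepFun_indicator_one_of_indepSet {s t : Set Ω} (h : IndepSet s t μ) :
    IndepFun (s.indicator (1 : Ω → ℝ)) (t.indicator (1 : Ω → ℝ)) μ := by
  have hcomap (u : Set Ω) : MeasurableSpace.comap (u.indicator (1 : Ω → ℝ)) inferInstance ≤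
      MeasurableSpace.generateFrom {u} :=
    Measurable.comap_le <| @Measurable.indicator _ _ _ _ (MeasurableSpace.generateFrom {u}) _ _
      measurable_const (MeasurableSpace.measurableSet_generateFrom rfl)
  rw [IndepFun_iff_Indep]
  exact indep_of_indep_of_le ((IndepSet_iff_Indep s t μ).1 h) (hcomap s) (hcomap t)

theorem integral_sum_indicator_one [IsFiniteMeasure μ] (hA : ∀ i, MeasurableSet (A i)) :
    ∫ ω, (∑ i ∈ I, (A i).indicator (1 : Ω → ℝ)) ω ∂μ = ∑ i ∈ I, μ.real (A i) := by
  have hintegrable (i : ι) : Integrable ((A i).indicator (1 : Ω → ℝ)) μ :=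
    (integrable_const (1 : ℝ)).indicator (hA i)
  simp only [Finset.sum_apply]
  rw [integral_finsetSum _ fun i _ ↦ hintegrable i]
  exact Finset.sum_congr rfl fun i _ ↦ integral_indicator_one (hA i)

theorem variance_sum_indicator_one_le [IsProbabilityMeasure μ] (hA : ∀ i, MeasurableSet (A i))
    (hind : Pairwise fun i j ↦ IndepSet (A i) (A j) μ) :
    Var[∑ i ∈ I, (A i).indicator (1 : Ω → ℝ); μ] ≤ ∑ i ∈ I, μ.real (A i) := by
  have hmem (i : ι) : MemLp ((A i).indicator (1 : Ω → ℝ)) 2 μ :=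
    memLp_indicator_const 2 (hA i) (1 : ℝ) (.inr (measure_ne_top _ _))
  rw [IndepFun.variance_sum (fun i _ ↦ hmem i)
    fun i _ j _ hij ↦ indepFun_indicator_one_of_indepSet (hind hij)]
  refine Finset.sum_le_sum fun i _ ↦ ?_
  have hsq : (A i).indicator (1 : Ω → ℝ) ^ 2 = (A i).indicator 1 := by
    ext ω
    by_cases h : ω ∈ A i <;> simp [h]
  calc Var[(A i).indicator (1 : Ω → ℝ); μ] ≤ ∫ ω, ((A i).indicator (1 : Ω → ℝ) ^ 2) ω ∂μ :=
        variance_le_expectation_sq (hmem i).1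
    _ = μ.real (A i) := by rw [hsq, integral_indicator_one (hA i)]

theorem measureReal_sum_indicator_one_le_half [IsProbabilityMeasure μ]
    (hA : ∀ i, MeasurableSet (A i)) (hind : Pairwise fun i j ↦ IndepSet (A i) (A j) μ)
    (hpos : 0 < ∑ i ∈ I, μ.real (A i)) :
    μ.real {ω | (∑ i ∈ I, (A i).indicator (1 : Ω → ℝ)) ω ≤ (∑ i ∈ I, μ.real (A i)) / 2} ≤
      4 / ∑ i ∈ I, μ.real (A i) := by
  set X : Ω → ℝ := ∑ i ∈ I, (A i).indicator 1
  set m := ∑ i ∈ I, μ.real (A i)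
  have hX : MemLp X 2 μ := memLp_finsetSum' _ fun i _ ↦
    memLp_indicator_const 2 (hA i) (1 : ℝ) (.inr (measure_ne_top _ _))
  have hmean : μ[X] = m := integral_sum_indicator_one hA
  have hsub : {ω | X ω ≤ m / 2} ⊆ {ω | m / 2 ≤ |X ω - μ[X]|} := fun ω (hω : X ω ≤ m / 2) ↦ by
    rw [mem_ofPred_eq, hmean, le_abs]
    exact .inr (by linarith)
  calc μ.real {ω | X ω ≤ m / 2} ≤ μ.real {ω | m / 2 ≤ |X ω - μ[X]|} := measureReal_mono hsub
    _ ≤ Var[X; μ] / (m / 2) ^ 2 :=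
        ENNReal.toReal_le_of_le_ofReal (div_nonneg (variance_nonneg X μ) (sq_nonneg _))
          (meas_ge_le_variance_div_sq hX (half_pos hpos))
    _ ≤ m / (m / 2) ^ 2 := by gcongr; exact variance_sum_indicator_one_le hA hind
    _ = 4 / m := by field_simp; norm_num

theorem measureReal_half_le_sum_indicator_one [IsFiniteMeasure μ] {F : ι → Set Ω} {η m : ℝ}
    (hF : ∀ i, MeasurableSet (F i)) (hm : 0 < m) (hFm : ∑ i ∈ I, μ.real (F i) ≤ η * m) :
    μ.real {ω | m / 2 ≤ (∑ i ∈ I, (F i).indicator (1 : Ω → ℝ)) ω} ≤ 2 * η := by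
  set Y : Ω → ℝ := ∑ i ∈ I, (F i).indicator 1
  have hY0 : 0 ≤ Y := Finset.sum_nonneg fun i _ ↦ indicator_nonneg fun _ _ ↦ zero_le_one
  have hYint : Integrable Y μ :=
    integrable_finsetSum' _ fun i _ ↦ (integrable_const (1 : ℝ)).indicator (hF i)
  have hmarkov : m / 2 * μ.real {ω | m / 2 ≤ Y ω} ≤ m / 2 * (2 * η) :=
    calc _ ≤ ∫ ω, Y ω ∂μ := mul_meas_ge_le_integral_of_nonneg (ae_of_all _ hY0) hYint (m / 2)
      _ ≤ η * m := (integral_sum_indicator_one hF).trans_le hFm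
      _ = m / 2 * (2 * η) := by ring
  exact le_of_mul_le_mul_left hmarkov (half_pos hm)

-- If no `E i` occurs, then every `A i` that occurs does so as `A i \ E i`: hence either few of the
-- `A i` occur, which Chebyshev's inequality makes unlikely, or many of the `A i \ E i` do.
theorem measureReal_forall_notMem_le [IsProbabilityMeasure μ] {η : ℝ}
    (hA : ∀ i, MeasurableSet (A i)) (hE : ∀ i, MeasurableSet (E i))
    (hind : Pairwise fun i j ↦ IndepSet (A i) (A j) μ)
    (hAE : ∀ i ∈ I, μ.real (A i \ E i) ≤ η * μ.real (A i))
    (hpos : 0 < ∑ i ∈ I, μ.real (A i)) :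
    μ.real {ω | ∀ i ∈ I, ω ∉ E i} ≤ 4 / (∑ i ∈ I, μ.real (A i)) + 2 * η := by
  set m := ∑ i ∈ I, μ.real (A i) with hm
  have hsub : {ω | ∀ i ∈ I, ω ∉ E i} ⊆ {ω | (∑ i ∈ I, (A i).indicator (1 : Ω → ℝ)) ω ≤ m / 2} ∪
      {ω | m / 2 ≤ (∑ i ∈ I, (A i \ E i).indicator (1 : Ω → ℝ)) ω} := by
    intro ω hω
    have hcount : (∑ i ∈ I, (A i).indicator (1 : Ω → ℝ)) ω =
        (∑ i ∈ I, (A i \ E i).indicator (1 : Ω → ℝ)) ω := by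
      simp only [Finset.sum_apply]
      refine Finset.sum_congr rfl fun i hi ↦ ?_
      have hωi : ω ∉ E i := hω i hi
      by_cases hAi : ω ∈ A i <;> simp [hAi, hωi]
    exact (le_total _ (m / 2)).imp id fun h ↦ h.trans_eq hcount
  have hdiff : ∑ i ∈ I, μ.real (A i \ E i) ≤ η * m := by
    rw [hm, Finset.mul_sum]
    exact Finset.sum_le_sum hAE
  exact (measureReal_mono hsub).trans <| (measureReal_union_le _ _).trans <|
    add_le_add (measureReal_sum_indicator_one_le_half hA hind hpos)
      (measureReal_half_le_sum_indicator_one (fun i ↦ (hA i).diff (hE i)) hpos hdiff)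

theorem exists_le_sum_Ico_of_not_summable {u : ℕ → ℝ} (hu0 : ∀ n, 0 ≤ u n) (hu : ¬ Summable u)
    (K : ℕ) (R : ℝ) : ∃ L, R ≤ ∑ n ∈ Finset.Ico K L, u n := by
  rw [← summable_nat_add_iff K, not_summable_iff_tendsto_nat_atTop_of_nonneg fun _ ↦ hu0 _] at hu
  obtain ⟨L, hL⟩ := (hu.eventually_ge_atTop R).exists
  refine ⟨K + L, hL.trans_eq ?_⟩
  rw [Finset.sum_Ico_eq_sum_range, Nat.add_sub_cancel_left]
  simp only [add_comm]

theorem ae_frequently_mem_of_measureReal_diff_le [IsProbabilityMeasure μ] {E : ℕ → Set Ω}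
    (hE : ∀ n, MeasurableSet (E n))
    (h : ∀ η > 0, ∃ A : ℕ → Set Ω, (∀ n, MeasurableSet (A n)) ∧
      (Pairwise fun i j ↦ IndepSet (A i) (A j) μ) ∧ (¬ Summable fun n ↦ μ.real (A n)) ∧
      ∀ᶠ n in atTop, μ.real (A n \ E n) ≤ η * μ.real (A n)) :
    ∀ᵐ ω ∂μ, ∃ᶠ n in atTop, ω ∈ E n := by
  suffices hnull : ∀ K : ℕ, μ.real {ω | ∀ n ≥ K, ω ∉ E n} = 0 by
    have hae (K : ℕ) : ∀ᵐ ω ∂μ, ¬ ∀ n ≥ K, ω ∉ E n :=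
      measure_eq_zero_iff_ae_notMem.1 ((measureReal_eq_zero_iff (measure_ne_top _ _)).1 (hnull K))
    filter_upwards [ae_all_iff.2 hae] with ω hω
    exact fun hev ↦ (eventually_atTop.1 hev).elim hω
  intro K
  refine le_antisymm (le_of_forall_pos_le_add fun ε hε ↦ ?_) measureReal_nonneg
  obtain ⟨A, hA, hind, hsum, hAE⟩ := h (ε / 4) (by positivity)
  obtain ⟨K', hK'⟩ := eventually_atTop.1 hAE
  obtain ⟨L, hL⟩ :=
    exists_le_sum_Ico_of_not_summable (fun _ ↦ measureReal_nonneg) hsum (max K K') (8 / ε)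
  have hge {n : ℕ} (hn : n ∈ Finset.Ico (max K K') L) : K ≤ n ∧ K' ≤ n :=
    max_le_iff.1 (Finset.mem_Ico.1 hn).1
  have hm : 0 < ∑ n ∈ Finset.Ico (max K K') L, μ.real (A n) :=
    lt_of_lt_of_le (by positivity) hL
  calc μ.real {ω | ∀ n ≥ K, ω ∉ E n} ≤ μ.real {ω | ∀ n ∈ Finset.Ico (max K K') L, ω ∉ E n} :=
        measureReal_mono fun ω hω n hn ↦ hω n (hge hn).1
    _ ≤ 4 / (∑ n ∈ Finset.Ico (max K K') L, μ.real (A n)) + 2 * (ε / 4) :=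
        measureReal_forall_notMem_le hA hE hind (fun n hn ↦ hK' n (hge hn).2) hm
    _ ≤ 4 / (8 / ε) + 2 * (ε / 4) := by gcongr
    _ = 0 + ε := by field_simp; ring

end BorelCantelli

section Orbits

theorem not_summable_inv_mul_log : ¬ Summable fun n : ℕ ↦ ((n : ℝ) * Real.log n)⁻¹ := by
  have hcond (k : ℕ) : (2 : ℝ) ^ k * (((2 ^ k : ℕ) : ℝ) * Real.log (2 ^ k : ℕ))⁻¹ =
      (Real.log 2)⁻¹ * (k : ℝ)⁻¹ := by
    push_cast
    rw [Real.log_pow]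
    field_simp
  rw [← summable_condensed_iff_of_eventually_nonneg]
  · simp only [hcond]
    rw [summable_mul_left_iff (inv_ne_zero (Real.log_pos one_lt_two).ne')]
    exact Real.not_summable_natCast_inv
  · exact .of_forall fun n ↦ inv_nonneg.2 (mul_nonneg n.cast_nonneg (Real.log_natCast_nonneg n))
  · filter_upwards [eventually_ge_atTop 2] with n hn
    have hn1 : (1 : ℝ) < n := by exact_mod_cast hn
    have hlog : 0 < Real.log n := Real.log_pos hn1
    gcongr <;> simp

theorem not_summable_measureReal_mul_log_le {Ω : Type*} [MeasurableSpace Ω] {μ : Measure Ω}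
    {f : Ω → ℝ} (htail : (fun t : ℝ ↦ t⁻¹) =O[atTop] fun t ↦ μ.real {ω | t ≤ f ω}) {c : ℝ}
    (hc : 0 < c) : ¬ Summable fun n : ℕ ↦ μ.real {ω | c * (n * Real.log n) ≤ f ω} := by
  intro hsum
  have hlevel : Tendsto (fun n : ℕ ↦ c * (n * Real.log n)) atTop atTop :=
    have hcast := tendsto_natCast_atTop_atTop (R := ℝ)
    (hcast.atTop_mul_atTop₀ (Real.tendsto_log_atTop.comp hcast)).const_mul_atTop hc
  have hinv : Summable fun n : ℕ ↦ (c * (n * Real.log n))⁻¹ :=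
    summable_of_isBigO_nat hsum (htail.comp_tendsto hlevel)
  simp only [mul_inv c] at hinv
  exact not_summable_inv_mul_log ((summable_mul_left_iff (inv_ne_zero hc.ne')).1 hinv)

theorem indepFun_of_measurePreserving_prodMk {Ω α β : Type*} [MeasurableSpace Ω]
    [MeasurableSpace α] [MeasurableSpace β] {P : Measure Ω} {μ : Measure α} {ν : Measure β}
    [IsProbabilityMeasure μ] [IsProbabilityMeasure ν] {X : Ω → α} {Y : Ω → β}
    (h : MeasurePreserving (fun ω ↦ (X ω, Y ω)) P (μ.prod ν)) : IndepFun X Y P := by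
  have : IsProbabilityMeasure P :=
    ⟨(h.measure_preimage MeasurableSet.univ.nullMeasurableSet).trans measure_univ⟩
  have hX : MeasurePreserving X P μ := measurePreserving_fst.comp h
  have hY : MeasurePreserving Y P ν := measurePreserving_snd.comp h
  rw [indepFun_iff_map_prod_eq_prod_map_map hX.aemeasurable hY.aemeasurable, h.map_eq, hX.map_eq,
    hY.map_eq]

theorem measureReal_prod_inter_le {α β : Type*} [MeasurableSpace α] [MeasurableSpace β]
    {μ : Measure α} {ν : Measure β} [IsFiniteMeasure μ] [IsFiniteMeasure ν] {A : Set α}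
    {B : Set (α × β)} (hA : MeasurableSet A) (hB : MeasurableSet B) {η : ℝ} (hη : 0 ≤ η)
    (hslice : ∀ a, ν.real (Prod.mk a ⁻¹' B) ≤ η) :
    (μ.prod ν).real (Prod.fst ⁻¹' A ∩ B) ≤ η * μ.real A := by
  have hslice' (a : α) : ν (Prod.mk a ⁻¹' (Prod.fst ⁻¹' A ∩ B)) ≤
      A.indicator (fun _ ↦ ENNReal.ofReal η) a := by
    by_cases ha : a ∈ A
    · rw [indicator_of_mem ha, ENNReal.le_ofReal_iff_toReal_le (measure_ne_top _ _) hη]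
      exact (measureReal_mono inter_subset_right).trans (hslice a)
    · rw [indicator_of_notMem ha]
      exact (measure_mono_null (fun _ hb ↦ ha hb.1) measure_empty).le
  have hprod : (μ.prod ν) (Prod.fst ⁻¹' A ∩ B) ≤ ENNReal.ofReal η * μ A := by
    rw [Measure.prod_apply ((measurable_fst hA).inter hB), ← lintegral_indicator_const hA]
    exact lintegral_mono hslice'
  rw [← ENNReal.toReal_ofReal hη]
  exact (ENNReal.toReal_mono (by finiteness) hprod).trans_eq ENNReal.toReal_mul

variable {G : Type*} [AddCommGroup G] [TopologicalSpace G] [IsTopologicalAddGroup G]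
  [SecondCountableTopology G] [MeasurableSpace G] [BorelSpace G]

theorem measurable_birkhoffSum_add_right {f : G → ℝ} (hf : Measurable f) (n : ℕ) :
    Measurable fun p : G × G ↦ birkhoffSum (· + p.1) f n p.2 := by
  simp only [birkhoffSum, add_right_iterate]
  fun_prop

variable [CompactSpace G] [DivisibleBy G ℤ] {μ : Measure G} [μ.IsAddHaarMeasure]

-- With `y = x + m • a`, the second orbit point is `y + (n - m) • a`, and multiplication by the
-- nonzero integer `n - m` preserves the Haar measure of a compact divisible group.
theorem measurePreserving_orbit_pair {m n : ℕ} (hmn : m ≠ n) :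
    MeasurePreserving (fun p : G × G ↦ (p.2 + m • p.1, p.2 + n • p.1))
      (μ.prod μ) (μ.prod μ) := by
  have hfirst : MeasurePreserving (fun p : G × G ↦ (p.1, p.2 + m • p.1))
      (μ.prod μ) (μ.prod μ) :=
    (MeasurePreserving.id μ).skew_product (g := fun a x ↦ x + m • a) (by fun_prop)
      (ae_of_all _ fun a ↦ map_add_right_eq_self μ _)
  have hsecond : MeasurePreserving (fun p : G × G ↦ (p.1, p.1 + ((n : ℤ) - m) • p.2))
      (μ.prod μ) (μ.prod μ) :=
    (MeasurePreserving.id μ).skew_product (g := fun x a ↦ x + ((n : ℤ) - m) • a) (by fun_prop)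
      (ae_of_all _ fun x ↦ ((measurePreserving_add_left μ x).comp
        (Measure.measurePreserving_zsmul μ (by omega))).map_eq)
  convert hsecond.comp (Measure.measurePreserving_swap.comp hfirst) using 2 with p
  simp [sub_smul]

variable [IsProbabilityMeasure μ]

theorem measurePreserving_orbit_point (n : ℕ) :
    MeasurePreserving (fun p : G × G ↦ p.2 + n • p.1) (μ.prod μ) μ :=
  measurePreserving_fst.comp (measurePreserving_orbit_pair n.lt_succ_self.ne)

theorem ae_frequently_mul_birkhoffSum_le {f : G → ℝ} (hf : Measurable f) (hf0 : 0 ≤ f)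
    (htail : (fun t ↦ μ.real {x | t ≤ f x}) =Θ[atTop] fun t : ℝ ↦ t⁻¹) {M : ℝ} (hM : 0 < M) :
    ∀ᵐ p : (G × G) × G ∂(μ.prod μ).prod μ, ∃ᶠ n in atTop,
      M * birkhoffSum (· + p.1.1) f n p.2 ≤ birkhoffSum (· + p.1.1) f n p.1.2 := by
  have hmeas (n : ℕ) : Measurable fun p : (G × G) × G ↦ birkhoffSum (· + p.1.1) f n p.2 :=
    (measurable_birkhoffSum_add_right hf n).comp (measurable_fst.fst.prodMk measurable_snd)
  set E : ℕ → Set ((G × G) × G) := fun n ↦ {p | M * birkhoffSum (· + p.1.1) f (n + 1) p.2 ≤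
    birkhoffSum (· + p.1.1) f (n + 1) p.1.2}
  suffices hE : ∀ᵐ p ∂(μ.prod μ).prod μ, ∃ᶠ n in atTop, p ∈ E n from
    hE.mono fun p hp ↦ (tendsto_add_atTop_nat 1).frequently hp
  refine ae_frequently_mem_of_measureReal_diff_le
    (fun n ↦ measurableSet_le ((hmeas _).const_mul M)
      ((measurable_birkhoffSum_add_right hf _).comp measurable_fst)) fun η hη ↦ ?_
  obtain ⟨C, hC, hsmall⟩ := exists_eventually_measureReal_lt_birkhoffSum_le hf hf0 htail.1 hη
  set r : ℕ → ℝ := fun n ↦ C * ((n + 1 : ℕ) * Real.log (n + 1 : ℕ))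
  set B : ℕ → Set (G × G) := fun n ↦ (fun q ↦ q.2 + n • q.1) ⁻¹' {x | M * r n ≤ f x}
  have hlevel (n : ℕ) : MeasurableSet {x | M * r n ≤ f x} := measurableSet_le measurable_const hf
  have hB (n : ℕ) : MeasurableSet (B n) :=
    (measurePreserving_orbit_point (μ := μ) n).measurable (hlevel n)
  have hBr (n : ℕ) : (μ.prod μ).real (B n) = μ.real {x | M * r n ≤ f x} :=
    (measurePreserving_orbit_point n).measureReal_preimage (hlevel n).nullMeasurableSet
  refine ⟨fun n ↦ Prod.fst ⁻¹' B n, fun n ↦ measurable_fst (hB n), fun i j hij ↦ ?_, ?_, ?_⟩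
  · have hpair := (measurePreserving_orbit_pair (μ := μ) hij).comp (measurePreserving_fst (ν := μ))
    exact (indepFun_iff_indepSet_preimage hpair.measurable.fst hpair.measurable.snd).1
      (indepFun_of_measurePreserving_prodMk hpair) _ _ (hlevel i) (hlevel j)
  · simp only [measurePreserving_fst.measureReal_preimage (hB _).nullMeasurableSet, hBr, r,
      ← mul_assoc M C]
    exact fun hsum ↦ not_summable_measureReal_mul_log_le htail.2 (mul_pos hM hC)
      ((summable_nat_add_iff 1).1 hsum)
  · filter_upwards [(tendsto_add_atTop_nat 1).eventually hsmall] with n hn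
    have hsub : Prod.fst ⁻¹' B n \ E n ⊆
        Prod.fst ⁻¹' B n ∩ {p | r n < birkhoffSum (· + p.1.1) f (n + 1) p.2} := by
      rintro p ⟨hpB, hpE⟩
      refine ⟨hpB, lt_of_mul_lt_mul_left ?_ hM.le⟩
      calc M * r n ≤ f ((· + p.1.1)^[n] p.1.2) := by rwa [add_right_iterate_apply]
        _ ≤ birkhoffSum (· + p.1.1) f (n + 1) p.1.2 := apply_iterate_le_birkhoffSum_succ hf0 n _
        _ < M * birkhoffSum (· + p.1.1) f (n + 1) p.2 := not_le.1 hpE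
    calc _ ≤ _ := measureReal_mono hsub
      _ ≤ η * (μ.prod μ).real (B n) :=
        measureReal_prod_inter_le (hB n) (measurableSet_lt measurable_const (hmeas _)) hη.le
          fun q ↦ hn _ (measurePreserving_add_right μ q.1)
      _ = _ := by rw [measurePreserving_fst.measureReal_preimage (hB n).nullMeasurableSet]

end Orbits

section LimsupRatio

variable {ι : Type*} {l : Filter ι} {a b : ι → ℝ}

theorem limsup_coe_div_eq_top_of_frequently (hb : ∀ᶠ i in l, 0 < b i)
    (h : ∀ M : ℝ, ∃ᶠ i in l, M * b i ≤ a i) :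
    limsup (fun i ↦ ((a i / b i : ℝ) : EReal)) l = ⊤ := by
  refine (EReal.eq_top_iff_forall_lt _).2 fun M ↦ ?_
  have hfreq : ∃ᶠ i in l, ((M + 1 : ℝ) : EReal) ≤ ((a i / b i : ℝ) : EReal) :=
    ((h (M + 1)).and_eventually hb).mono fun i hi ↦
      EReal.coe_le_coe_iff.2 ((le_div_iff₀ hi.2).2 hi.1)
  exact (EReal.coe_lt_coe_iff.2 (lt_add_one M)).trans_le (le_limsup_of_frequently_le' hfreq)

theorem liminf_coe_div_eq_zero_of_frequently (ha : ∀ᶠ i in l, 0 ≤ a i) (hb : ∀ᶠ i in l, 0 < b i)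
    (h : ∀ M : ℝ, ∃ᶠ i in l, M * a i ≤ b i) :
    liminf (fun i ↦ ((a i / b i : ℝ) : EReal)) l = 0 := by
  refine le_antisymm (le_of_forall_gt_imp_ge_of_dense fun y hy ↦ ?_) <|
    le_liminf_of_le (by isBoundedDefault) <| by
      filter_upwards [ha, hb] with i hai hbi using EReal.coe_nonneg.2 (div_nonneg hai hbi.le)
  obtain ⟨r, hr, hry⟩ := EReal.lt_iff_exists_real_btwn.1 hy
  have hr0 : 0 < r := EReal.coe_pos.1 hr
  refine (liminf_le_of_frequently_le' ?_).trans hry.le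
  refine ((h r⁻¹).and_eventually hb).mono fun i hi ↦ EReal.coe_le_coe_iff.2 ?_
  rw [div_le_iff₀ hi.2]
  exact (inv_mul_le_iff₀ hr0).1 hi.1

end LimsupRatio

section BasePoints

theorem measurePreserving_prodAssoc_conj {α β γ β' γ' : Type*} [MeasurableSpace α]
    [MeasurableSpace β] [MeasurableSpace γ] [MeasurableSpace β'] [MeasurableSpace γ']
    {μ : Measure α} {ν : Measure β} {ρ : Measure γ} {ν' : Measure β'} {ρ' : Measure γ'}
    [SFinite μ] [SFinite ν] [SFinite ρ] [SFinite ν'] [SFinite ρ'] {φ : β × γ → β' × γ'}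
    (hφ : MeasurePreserving φ (ν.prod ρ) (ν'.prod ρ')) :
    MeasurePreserving
      (fun p : (α × β) × γ ↦ ((p.1.1, (φ (p.1.2, p.2)).1), (φ (p.1.2, p.2)).2))
      ((μ.prod ν).prod ρ) ((μ.prod ν').prod ρ') :=
  ((measurePreserving_prodAssoc μ ν' ρ').symm _).comp
    (((MeasurePreserving.id μ).prod hφ).comp (measurePreserving_prodAssoc μ ν ρ))

variable {G : Type*} [AddCommGroup G] [TopologicalSpace G] [IsTopologicalAddGroup G]
  [SecondCountableTopology G] [MeasurableSpace G] [BorelSpace G] {μ : Measure G}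

theorem measurePreserving_prod_swap_sub [SFinite μ] [μ.IsAddLeftInvariant] [μ.IsNegInvariant] :
    MeasurePreserving (fun z : G × G ↦ (z.2, z.2 - z.1)) (μ.prod μ) (μ.prod μ) :=
  have hshear : MeasurePreserving (fun z : G × G ↦ (z.1, z.1 - z.2)) (μ.prod μ) (μ.prod μ) :=
    (MeasurePreserving.id μ).skew_product (g := fun x y ↦ x - y) (by fun_prop)
      (ae_of_all _ fun x ↦ (Measure.measurePreserving_sub_left μ x).map_eq)
  hshear.comp Measure.measurePreserving_swap

variable [CompactSpace G] [DivisibleBy G ℤ] [μ.IsAddHaarMeasure] [IsProbabilityMeasure μ]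

theorem ae_forall_frequently_mul_birkhoffSum_le {f : G → ℝ} (hf : Measurable f) (hf0 : 0 ≤ f)
    (htail : (fun t ↦ μ.real {x | t ≤ f x}) =Θ[atTop] fun t : ℝ ↦ t⁻¹) :
    ∀ᵐ p : (G × G) × G ∂(μ.prod μ).prod μ, ∀ M : ℝ, ∃ᶠ n in atTop,
      M * birkhoffSum (· + p.1.1) f n p.2 ≤ birkhoffSum (· + p.1.1) f n p.1.2 := by
  have hnat := ae_all_iff.2 fun k : ℕ ↦
    ae_frequently_mul_birkhoffSum_le hf hf0 htail (M := k + 1) (by positivity)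
  filter_upwards [hnat] with p hp M
  obtain ⟨k, hk⟩ := exists_nat_ge M
  refine (hp k).mono fun n hn ↦ le_trans ?_ hn
  have hsum : 0 ≤ birkhoffSum (· + p.1.1) f n p.2 := Finset.sum_nonneg fun _ _ ↦ hf0 _
  gcongr
  linarith

end BasePoints

section Phi

theorem phi_coe {x : ℝ} (hx : x ∈ Ico (0 : ℝ) 1) : phi x = 1 / x + 1 / (1 - x) := by
  have hrep : (AddCircle.equivIco 1 0 (x : UnitAddCircle) : ℝ) = x := by
    rw [AddCircle.equivIco_coe_eq (by simpa using hx)]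
  rw [phi, hrep]

theorem phi_pos (z : UnitAddCircle) : 0 < phi z := by
  have hz := (AddCircle.equivIco 1 0 z).2
  exact add_pos_of_nonneg_of_pos (one_div_nonneg.2 hz.1) (one_div_pos.2 (by linarith [hz.2]))

theorem measurable_phi : Measurable phi := by
  have hrep : Measurable fun z : UnitAddCircle ↦ (AddCircle.equivIco 1 0 z : ℝ) :=
    measurable_subtype_coe.comp (AddCircle.measurableEquivIco (1 : ℝ) 0).measurable
  unfold phi
  fun_prop

theorem volume_real_eq_volume_real_inter_Ioo {s : Set UnitAddCircle} (hs : MeasurableSet s) :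
    volume.real s = volume.real (((↑) : ℝ → UnitAddCircle) ⁻¹' s ∩ Ioo 0 1) := by
  have hmk := UnitAddCircle.measurePreserving_mk 0
  rw [zero_add, ← restrict_Ioo_eq_restrict_Ioc] at hmk
  rw [← hmk.measureReal_preimage hs.nullMeasurableSet,
    measureReal_restrict_apply (hmk.measurable hs)]

theorem volume_real_le_phi (t : ℝ) : volume.real {z | t ≤ phi z} =
    volume.real {x : ℝ | x ∈ Ioo 0 1 ∧ t ≤ 1 / x + 1 / (1 - x)} := by
  rw [volume_real_eq_volume_real_inter_Ioo (measurableSet_le measurable_const measurable_phi)]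
  congr 1 with x
  exact and_comm.trans (and_congr_right fun hx ↦ by
    rw [mem_preimage, mem_ofPred_eq, phi_coe (Ioo_subset_Ico_self hx)])

theorem inv_le_volume_real_le_phi {t : ℝ} (ht : 1 ≤ t) : t⁻¹ ≤ volume.real {z | t ≤ phi z} := by
  have ht0 : 0 < t := zero_lt_one.trans_le ht
  have hsub : Ioo 0 t⁻¹ ⊆ {x : ℝ | x ∈ Ioo 0 1 ∧ t ≤ 1 / x + 1 / (1 - x)} := by
    intro x ⟨hx0, hxt⟩
    have hx1 : x < 1 := hxt.trans_le (inv_le_one_of_one_le₀ ht)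
    have htx : t ≤ 1 / x := ((lt_one_div ht0 hx0).2 (by rwa [one_div])).le
    exact ⟨⟨hx0, hx1⟩, le_add_of_le_of_nonneg htx (one_div_nonneg.2 (sub_nonneg.2 hx1.le))⟩
  rw [volume_real_le_phi]
  calc t⁻¹ = volume.real (Ioo 0 t⁻¹) := by
        rw [Real.volume_real_Ioo_of_le (inv_nonneg.2 ht0.le), sub_zero]
    _ ≤ _ := measureReal_mono hsub ((measure_mono fun _ h ↦ h.1).trans_lt measure_Ioo_lt_top).ne

theorem volume_real_le_phi_le {t : ℝ} (ht : 0 < t) :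
    volume.real {z | t ≤ phi z} ≤ 4 * t⁻¹ := by
  have hsub : {x : ℝ | x ∈ Ioo 0 1 ∧ t ≤ 1 / x + 1 / (1 - x)} ⊆
      Ioc 0 (2 / t) ∪ Ico (1 - 2 / t) 1 := by
    rintro x ⟨⟨hx0, hx1⟩, hxt⟩
    have hhalf : t / 2 ≤ 1 / x ∨ t / 2 ≤ 1 / (1 - x) := by
      by_contra! h
      linarith
    refine hhalf.imp (fun h ↦ ⟨hx0, ?_⟩) fun h ↦ ⟨?_, hx1⟩
    · simpa using (le_one_div (half_pos ht) hx0).1 h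
    · have hx : 1 - x ≤ 2 / t := by
        simpa using (le_one_div (half_pos ht) (sub_pos.2 hx1)).1 h
      linarith
  rw [volume_real_le_phi]
  calc _ ≤ volume.real (Ioc 0 (2 / t) ∪ Ico (1 - 2 / t) 1) :=
        measureReal_mono hsub (measure_union_lt_top measure_Ioc_lt_top measure_Ico_lt_top).ne
    _ ≤ volume.real (Ioc 0 (2 / t)) + volume.real (Ico (1 - 2 / t) 1) := measureReal_union_le _ _
    _ = 4 * t⁻¹ := by
        have ht2 : 0 ≤ 2 / t := by positivity
        rw [Real.volume_real_Ioc_of_le ht2, Real.volume_real_Ico_of_le (by linarith)]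
        ring

theorem isTheta_volume_real_le_phi :
    (fun t ↦ volume.real {z | t ≤ phi z}) =Θ[atTop] fun t : ℝ ↦ t⁻¹ := by
  constructor
  · refine .of_bound 4 ?_
    filter_upwards [eventually_gt_atTop 0] with t ht
    simpa only [Real.norm_of_nonneg measureReal_nonneg, Real.norm_of_nonneg (inv_nonneg.2 ht.le)]
      using volume_real_le_phi_le ht
  · refine .of_bound 1 ?_
    filter_upwards [eventually_ge_atTop 1] with t ht
    have ht0 : 0 ≤ t⁻¹ := inv_nonneg.2 (zero_le_one.trans ht)
    simpa only [Real.norm_of_nonneg measureReal_nonneg, Real.norm_of_nonneg ht0, one_mul]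
      using inv_le_volume_real_le_phi ht

end Phi

theorem mainTheorem5_general {G : Type*} [AddCommGroup G] [TopologicalSpace G]
    [IsTopologicalAddGroup G] [SecondCountableTopology G] [CompactSpace G] [DivisibleBy G ℤ]
    [MeasurableSpace G] [BorelSpace G] (μ : Measure G) [μ.IsAddHaarMeasure]
    [IsProbabilityMeasure μ] {f : G → ℝ} (hf : Measurable f) (hf0 : ∀ x, 0 < f x)
    (htail : (fun t ↦ μ.real {x | t ≤ f x}) =Θ[atTop] fun t : ℝ ↦ t⁻¹) :
    ∃ Z : Set (G × G), MeasurableSet Z ∧ (μ.prod μ) Zᶜ = 0 ∧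
      ∀ α β : G, (α, β) ∈ Z → ∀ᵐ x ∂μ,
        limsup (fun n : ℕ ↦ ((birkhoffSum (· + α) f n x /
          birkhoffSum (· + α) f n (x - β) : ℝ) : EReal)) atTop = ⊤ ∧
        liminf (fun n : ℕ ↦ ((birkhoffSum (· + α) f n x /
          birkhoffSum (· + α) f n (x - β) : ℝ) : EReal)) atTop = 0 := by
  have hratio := ae_forall_frequently_mul_birkhoffSum_le hf (fun x ↦ (hf0 x).le) htail
  have hshear : MeasurePreserving (fun z : G × G ↦ (z.2, z.2 - z.1)) (μ.prod μ) (μ.prod μ) :=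
    measurePreserving_prod_swap_sub
  have hlarge := (measurePreserving_prodAssoc_conj (μ := μ) hshear).quasiMeasurePreserving.ae hratio
  have hsmall := (measurePreserving_prodAssoc_conj (μ := μ)
    (Measure.measurePreserving_swap.comp hshear)).quasiMeasurePreserving.ae hratio
  obtain ⟨N, hN, hNmeas, hN0⟩ := exists_measurable_superset_of_null
    (ae_iff.1 (Measure.ae_ae_of_ae_prod (hlarge.and hsmall)))
  refine ⟨Nᶜ, hNmeas.compl, by rwa [compl_compl], fun α β hαβ ↦ ?_⟩
  filter_upwards [not_not.1 fun h ↦ hαβ (hN h)] with x hx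
  have hpos (y : G) : ∀ᶠ n in atTop, 0 < birkhoffSum (· + α) f n y :=
    (eventually_ne_atTop 0).mono fun n hn ↦ birkhoffSum_pos hf0 hn y
  exact ⟨limsup_coe_div_eq_top_of_frequently (hpos _) hx.1,
    liminf_coe_div_eq_zero_of_frequently ((hpos _).mono fun _ ↦ le_of_lt) (hpos _) hx.2⟩

theorem mainTheorem5 :
    ∃ Z : Set (UnitAddCircle × UnitAddCircle),
      MeasurableSet Z ∧ MeasureTheory.volume Zᶜ = 0 ∧
      ∀ α β : UnitAddCircle, (α, β) ∈ Z →
        ∀ᵐ x : UnitAddCircle ∂MeasureTheory.volume,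
          Filter.limsup (fun N : ℕ => ((Theta α β N x : ℝ) : EReal)) Filter.atTop = ⊤ ∧
          Filter.liminf (fun N : ℕ => ((Theta α β N x : ℝ) : EReal)) Filter.atTop = 0 := by
  have : IsProbabilityMeasure (volume : Measure UnitAddCircle) := ⟨UnitAddCircle.measure_univ⟩
  exact mainTheorem5_general volume measurable_phi phi_pos isTheta_volume_real_le_phi
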